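/- All rings are commutative with unit. For a ring extension $R\subseteq S$, let $[R,S]$ be the set of all rings $T$ with $R\subseteq T\subseteq S$; the extension is called Prüfer if $R\to T$ is a flat epimorphism of commutative rings for every $T\in[R,S]$. A ring is called semi-hereditary if each of its finitely generated ideals is a projective module. Let $R\subseteq S$ be a ring extension such that $R$ is integrally closed in $S$. Let $V$ be a semi-hereditary ring with total quotient ring $K$, and let $f\colon R\to V$ and $g\colon S\to K$ be ring morphisms such that the square $$\begin{array}{ccc} R & \hookrightarrow & S\\ {\scriptstyle f}\downarrow & & \downarrow{\scriptstyle g}\\ V & \hookrightarrow & K\end{array}$$ is a pullback. For $T\in[R,S]$, let $g(T)V$ be the subring of $K$ generated by $g(T)$ and $V$. Then the following are equivalent: 1. $R\subseteq S$ is Prüfer; 2. $g(T)V\cap g(S)=g(T)$ for every $T\in[R,S]$; 3. for every $T\in[R,S]$, the square $$\begin{array}{ccc} T & \hookrightarrow & S\\ \downarrow & & \downarrow{\scriptstyle g}\\ g(T)V & \hookrightarrow & K,\end{array}$$ whose left-hand map is induced by $g$, is a pullback. If these conditions hold, then for every $T\in[R,S]$ one has $R=V\times_{g(T)V}T$ (that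 is, the square formed by $R\hookrightarrow T$, $f\colon R\to V$, $T\to g(T)V$ and $V\hookrightarrow g(T)V$ is a pullback), and the canonical map $V\otimes_R T\to g(T)V$, $v\otimes t\mapsto v\,g(t)$, is an isomorphism of $V$-algebras. -/

import Mathlib

open scoped TensorProduct

/-- A commutative ring is semi-hereditary if each of its finitely generated ideals is a
projective module. -/
def IsSemihereditary (V : Type*) [CommRing V] : Prop :=
  ∀ I : Ideal V, I.FG → Module.Projective V I

/-- The ring extension `R ⊆ S` is Prüfer: `R ⊆ T` is a flat epimorphism (of commutative rings) for
each intermediate ring `T`. -/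
structure IsPruferExtension (R S : Type*) [CommRing R] [CommRing S] [Algebra R S] : Prop where
  injective : Function.Injective (algebraMap R S)
  flat : ∀ T : Subalgebra R S, Module.Flat R T
  isEpi : ∀ T : Subalgebra R S, Algebra.IsEpi R T

/-- The square of commutative rings with top `i : A → B`, left `f : A → C`, right `g : B → D` and
bottom `j : C → D` is a pullback: it commutes, and `a ↦ (i a, f a)` is a bijection
of `A` onto the fibre product of `B` and `C` over `D`. -/
structure IsPullbackSquare {A B C D : Type*} [CommRing A] [CommRing B] [CommRing C] [CommRing D]
    (i : A →+* B) (f : A →+* C) (g : B →+* D) (j : C →+* D) : Prop where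
  comm : g.comp i = j.comp f
  existsUnique : ∀ (b : B) (c : C), g b = j c → ∃! a : A, i a = b ∧ f a = c

section Compositum

variable {R S K : Type*} (V : Type*) [CommRing R] [CommRing S] [CommRing V] [CommRing K]
  [Algebra R S] [Algebra V K]

/-- The ring `g(T)V`: the subring of `K` generated by `g(T)` and (the image of) `V`. -/
def compositum (g : S →+* K) (T : Subalgebra R S) : Subalgebra V K :=
  Algebra.adjoin V (g '' (T : Set S))

theorem map_mem_compositum (g : S →+* K) (T : Subalgebra R S) (t : T) :
    (g.comp T.val.toRingHom) t ∈ compositum V g T :=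
  Algebra.subset_adjoin ⟨t, t.2, rfl⟩

/-- The ring morphism `T → g(T)V` induced by `g`. -/
def toCompositum (g : S →+* K) (T : Subalgebra R S) : T →+* compositum V g T :=
  (g.comp T.val.toRingHom).codRestrict (compositum V g T) (map_mem_compositum V g T)

end Compositum

/-! Conditions 2 and 3 both say that g(s) ∈ g(T)V forces s ∈ T; for 2 this uses ker g ⊆ R. Flat
epimorphisms R → T are handled by denominator ideals: the condition is that (R : t)T = T for all t ∈
T. If R ⊆ S is Prüfer and g(s) = ∑ vᵢ g(tᵢ), a common denominator c of the tᵢ makes g(cs) lie in V,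
so cs ∈ R by the pullback; such c generate the unit ideal of T, so s ∈ T
(`mem_of_map_mem_compositum`). Conversely, rings between V and K are closed under square roots, so
the condition applied to R[t²] gives t ∈ R[t²]. This is a polynomial relation with a unit
coefficient, and integral closedness turns it into (R : t)T = T. -/

/-- The ideal of those `r : R` for which `r • x` lies in the image of `R`. -/
def denominatorIdeal (R : Type*) {A : Type*} [CommRing R] [CommRing A] [Algebra R A] (x : A) :
    Ideal R :=
  (LinearMap.range (Algebra.linearMap R A)).comap (LinearMap.toSpanSingleton R A x)

/-! ### Denominator ideals and flat epimorphisms -/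

section DenominatorIdeal

variable {R A : Type*} [CommRing R] [CommRing A] [Algebra R A]

theorem mem_denominatorIdeal {x : A} {r : R} :
    r ∈ denominatorIdeal R x ↔ ∃ s : R, algebraMap R A s = r • x :=
  Iff.rfl

/-- If the denominator ideals of all elements of `A` extend to the unit ideal, finitely many
elements of `A` have common denominators generating the unit ideal. -/
theorem exists_common_denominators (h : ∀ x : A, (denominatorIdeal R x).map (algebraMap R A) = ⊤)
    {ι : Type*} (s : Finset ι) (x : ι → A) :
    ∃ (n : ℕ) (c : Fin n → R) (u : Fin n → A),
      (∀ i ∈ s, ∀ j, c j ∈ denominatorIdeal R (x i)) ∧ ∑ j, c j • u j = 1 := by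
  have hprod : (∏ i ∈ s, denominatorIdeal R (x i)).map (algebraMap R A) = ⊤ := by
    rw [← Ideal.mapHom_apply, map_prod]
    simp [h]
  have h1 : (1 : A) ∈ Submodule.span A
      (algebraMap R A '' (∏ i ∈ s, denominatorIdeal R (x i) : Ideal R)) := by
    change (1 : A) ∈ (∏ i ∈ s, denominatorIdeal R (x i)).map (algebraMap R A)
    rw [hprod]
    trivial
  obtain ⟨n, u, c, huc⟩ := Submodule.mem_span_set'.mp h1
  choose d hd hdc using fun j => (c j).2
  refine ⟨n, d, u, fun i hi j => ?_, ?_⟩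
  · exact (Ideal.prod_le_inf.trans (Finset.inf_le hi)) (hd j)
  · rw [← huc]
    refine Finset.sum_congr rfl fun j _ => ?_
    rw [← hdc, Algebra.smul_def, smul_eq_mul, mul_comm]

/-- Equational criterion: common denominators `c j` with `∑ c j • u j = 1` rewrite each `x i` over
the `u j` with coefficients `c j • x i` in `R`. -/
theorem flat_of_map_denominatorIdeal_eq_top (hinj : Function.Injective (algebraMap R A))
    (h : ∀ x : A, (denominatorIdeal R x).map (algebraMap R A) = ⊤) : Module.Flat R A := by
  refine Module.Flat.of_forall_isTrivialRelation fun {l f x} hfx => ?_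
  obtain ⟨n, c, u, hc, hu⟩ := exists_common_denominators h Finset.univ x
  choose a ha using fun i j => mem_denominatorIdeal.mp (hc i (Finset.mem_univ i) j)
  refine ⟨n, a, u, fun i => ?_, fun j => hinj ?_⟩
  · calc x i = x i * ∑ j, c j • u j := by rw [hu, mul_one]
      _ = _ := by
        rw [Finset.mul_sum]
        refine Finset.sum_congr rfl fun j _ => ?_
        rw [Algebra.smul_def (a i j), ha, mul_smul_comm, smul_mul_assoc]
  · calc algebraMap R A (∑ i, f i * a i j) = c j • ∑ i, f i • x i := by
          rw [map_sum, Finset.smul_sum]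
          refine Finset.sum_congr rfl fun i _ => ?_
          rw [map_mul, ha, ← Algebra.smul_def, smul_comm]
      _ = algebraMap R A 0 := by rw [hfx, smul_zero, map_zero]

theorem isEpi_of_map_denominatorIdeal_eq_top
    (h : ∀ x : A, (denominatorIdeal R x).map (algebraMap R A) = ⊤) : Algebra.IsEpi R A := by
  refine (Algebra.isEpi_iff_forall_one_tmul_eq R A).mpr fun x => ?_
  obtain ⟨n, c, u, hc, hu⟩ := exists_common_denominators h {()} fun _ => x
  choose a ha using fun j => mem_denominatorIdeal.mp (hc () (Finset.mem_singleton_self _) j)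
  calc (1 : A) ⊗ₜ[R] x = ∑ j, u j ⊗ₜ[R] (c j • x) := by
        rw [← hu, TensorProduct.sum_tmul]
        simp only [TensorProduct.smul_tmul]
    _ = ∑ j, (c j • (x * u j)) ⊗ₜ[R] (1 : A) := by
        refine Finset.sum_congr rfl fun j _ => ?_
        rw [← ha, Algebra.algebraMap_eq_smul_one, ← TensorProduct.smul_tmul, Algebra.smul_def, ha,
          smul_mul_assoc]
    _ = x ⊗ₜ[R] 1 := by
        rw [← TensorProduct.sum_tmul]
        simp only [← mul_smul_comm]
        rw [← Finset.mul_sum, hu, mul_one]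

/-- Since 1 ⊗ x = x ⊗ 1, the class of x dies in A ⊗ (A/R). By flatness the kernel of A → A ⊗ (A/R),
a ↦ a ⊗ x, is the image of A ⊗ (R : x), so it contains 1. -/
theorem map_denominatorIdeal_eq_top_of_flat_of_isEpi [Module.Flat R A] [Algebra.IsEpi R A]
    (x : A) : (denominatorIdeal R x).map (algebraMap R A) = ⊤ := by
  let N := LinearMap.range (Algebra.linearMap R A)
  have hker : LinearMap.ker (N.mkQ ∘ₗ LinearMap.toSpanSingleton R A x) = denominatorIdeal R x := by
    rw [LinearMap.ker_comp, Submodule.ker_mkQ]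
    rfl
  have hexact : Function.Exact (denominatorIdeal R x).subtype
      (N.mkQ ∘ₗ LinearMap.toSpanSingleton R A x) := by
    rw [LinearMap.exact_iff, hker, Submodule.range_subtype]
  have hzero : LinearMap.lTensor A (N.mkQ ∘ₗ LinearMap.toSpanSingleton R A x)
      ((1 : A) ⊗ₜ[R] (1 : R)) = 0 := by
    have h1 : N.mkQ 1 = 0 := (Submodule.Quotient.mk_eq_zero N).mpr ⟨1, by simp⟩
    have h2 := congrArg (LinearMap.lTensor A N.mkQ)
      ((Algebra.isEpi_iff_forall_one_tmul_eq R A).mp ‹_› x)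
    rw [LinearMap.lTensor_tmul, LinearMap.lTensor_tmul, h1, TensorProduct.tmul_zero] at h2
    simpa using h2
  obtain ⟨y, hy⟩ := (Module.Flat.lTensor_exact A hexact _).mp hzero
  have key : ∀ z : A ⊗[R] denominatorIdeal R x,
      TensorProduct.rid R A (LinearMap.lTensor A (denominatorIdeal R x).subtype z) ∈
        (denominatorIdeal R x).map (algebraMap R A) := by
    intro z
    induction z using TensorProduct.induction_on with
    | zero => simp
    | tmul a r =>
      rw [LinearMap.lTensor_tmul, TensorProduct.rid_tmul, Algebra.smul_def]
      exact Ideal.mul_mem_right _ _ (Ideal.mem_map_of_mem _ r.2)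
    | add z w hz hw =>
      rw [map_add, map_add]
      exact Ideal.add_mem _ hz hw
  rw [Ideal.eq_top_iff_one]
  simpa [hy] using key y

open Polynomial in
/-- If `R` is integrally closed in `A`, the coefficients of a polynomial vanishing at `x` lie in
the extension of the denominator ideal of `x`. -/
theorem algebraMap_coeff_mem_map_denominatorIdeal (hR : IsIntegrallyClosedIn R A) (x : A) (n : ℕ) :
    ∀ p : R[X], p.natDegree ≤ n → aeval x p = 0 → ∀ k,
      algebraMap R A (p.coeff k) ∈ (denominatorIdeal R x).map (algebraMap R A) := by
  induction n with
  | zero =>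
    intro p hp hpx k
    rw [eq_C_of_natDegree_le_zero hp] at hpx ⊢
    rw [aeval_C] at hpx
    rw [coeff_C]
    split_ifs
    · rw [hpx]
      exact zero_mem _
    · simp
  | succ n ih =>
    intro p hp hpx k
    rcases hp.lt_or_eq with hlt | heq
    · exact ih p (Nat.lt_succ_iff.mp hlt) hpx k
    obtain ⟨r, hr⟩ := hR.isIntegral_iff.mp (isIntegral_leadingCoeff_smul p x hpx)
    have ha : algebraMap R A p.leadingCoeff ∈ (denominatorIdeal R x).map (algebraMap R A) :=
      Ideal.mem_map_of_mem _ (mem_denominatorIdeal.mpr ⟨r, hr⟩)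
    have hr' : algebraMap R A r ∈ (denominatorIdeal R x).map (algebraMap R A) := by
      rw [hr, Algebra.smul_def]
      exact Ideal.mul_mem_right _ _ ha
    have hp' : p = p.eraseLead + monomial (n + 1) p.leadingCoeff := by
      rw [← heq, eraseLead_add_monomial_natDegree_leadingCoeff]
    -- With leading coefficient a and r = ax ∈ R, replacing aXⁿ⁺¹ by rXⁿ keeps the value at x and
    -- lowers the degree; a and r both lie in the extended ideal.
    have hq := ih (p.eraseLead + monomial n r) ?_ ?_ k
    · rw [hp', coeff_add, map_add]
      rw [coeff_add, map_add, coeff_monomial] at hq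
      refine add_mem ?_ ?_
      · refine (add_mem_cancel_right ?_).mp hq
        split_ifs
        · exact hr'
        · simp
      · rw [coeff_monomial]
        split_ifs
        · exact ha
        · simp
    · refine (natDegree_add_le _ _).trans (max_le ?_ (natDegree_monomial_le r))
      exact (eraseLead_natDegree_le p).trans (by omega)
    · rw [← hpx]
      conv_rhs => rw [hp']
      rw [map_add, map_add, aeval_monomial, aeval_monomial, hr, Algebra.smul_def, pow_succ']
      ring

open Polynomial in
theorem map_denominatorIdeal_eq_top_of_mem_adjoin_sq (hR : IsIntegrallyClosedIn R A) {x : A}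
    (hx : x ∈ Algebra.adjoin R {x ^ 2}) : (denominatorIdeal R x).map (algebraMap R A) = ⊤ := by
  rw [Algebra.adjoin_singleton_eq_range_aeval] at hx
  obtain ⟨p, hp⟩ := hx
  have hp : aeval (x ^ 2) p = x := hp
  -- The polynomial p(X²) - X vanishes at x and has X-coefficient -1.
  have h := algebraMap_coeff_mem_map_denominatorIdeal hR x _ (expand R 2 p - X) le_rfl
    (by rw [map_sub, expand_aeval, hp, aeval_X, sub_self]) 1
  rw [coeff_sub, coeff_expand two_pos, coeff_X_one] at h
  rw [Ideal.eq_top_iff_one]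
  simpa using h

end DenominatorIdeal

/-! ### Semi-hereditary rings -/

/-- For x = a/b, the surjection V² → (a, b) has a section s. The coordinates of s(b) are p and q,
and b s(a) = a s(b) puts qx in V. -/
theorem IsSemihereditary.exists_mul_add_eq_one {V K : Type*} [CommRing V] [CommRing K]
    [Algebra V K] [IsFractionRing V K] (hV : IsSemihereditary V) (x : K) :
    ∃ p q r : V, algebraMap V K p * x + algebraMap V K q = 1 ∧
      algebraMap V K q * x = algebraMap V K r := by
  obtain ⟨a, b, rfl⟩ := IsLocalization.exists_mk'_eq (nonZeroDivisors V) x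
  set x := IsLocalization.mk' K a b
  have hb : IsUnit (algebraMap V K b) := IsLocalization.map_units K b
  have hxb : x * algebraMap V K b = algebraMap V K a := IsLocalization.mk'_spec K a b
  let I : Ideal V := Ideal.span {a, (b : V)}
  let a' : I := ⟨a, Ideal.subset_span (by simp)⟩
  let b' : I := ⟨b, Ideal.subset_span (by simp)⟩
  have : Module.Projective V I := hV I (Submodule.fg_span (Set.toFinite _))
  let φ : V × V →ₗ[V] I :=
    (LinearMap.toSpanSingleton V I a').coprod (LinearMap.toSpanSingleton V I b')
  have hφ : Function.Surjective φ := by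
    rintro ⟨y, hy⟩
    obtain ⟨c, d, hcd⟩ := Ideal.mem_span_pair.mp hy
    exact ⟨(c, d), Subtype.ext (by simpa [φ, a', b'] using hcd)⟩
  obtain ⟨s, hs⟩ := Module.projective_lifting_property φ LinearMap.id hφ
  have hcomm : (b : V) • s a' = a • s b' := by
    rw [← map_smul, ← map_smul]
    congr 1
    exact Subtype.ext (mul_comm _ _)
  have hsum : (s b').1 * a + (s b').2 * b = b := by
    simpa [φ, a', b'] using congrArg Subtype.val (LinearMap.congr_fun hs b')
  refine ⟨(s b').1, (s b').2, (s a').2, hb.mul_right_cancel ?_, hb.mul_right_cancel ?_⟩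
  · rw [add_mul, mul_assoc, hxb, one_mul, ← map_mul, ← map_mul, ← map_add, hsum]
  · have h2 : (b : V) * (s a').2 = a * (s b').2 := congrArg Prod.snd hcomm
    rw [mul_assoc, hxb, ← map_mul, ← map_mul, mul_comm, ← h2, mul_comm]

/-- Subrings of `K` containing a semi-hereditary ring with total quotient ring `K` are closed under
square roots. -/
theorem IsSemihereditary.mem_of_sq_mem {V K : Type*} [CommRing V] [CommRing K]
    [Algebra V K] [IsFractionRing V K] (hV : IsSemihereditary V) (W : Subalgebra V K) {x : K}
    (hx : x ^ 2 ∈ W) : x ∈ W := by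
  obtain ⟨p, q, r, h1, h2⟩ := hV.exists_mul_add_eq_one x
  have : x = algebraMap V K p * x ^ 2 + algebraMap V K r := by
    rw [← h2]
    linear_combination -x * h1
  rw [this]
  exact add_mem (mul_mem (W.algebraMap_mem p) hx) (W.algebraMap_mem r)

/-! ### Pullback squares and the rings g(T)V -/

section Square

variable {R S V K : Type*} [CommRing R] [CommRing S] [CommRing V] [CommRing K]
  [Algebra R S] [Algebra V K] (g : S →+* K)

theorem isPullbackSquare_compositum_iff (T : Subalgebra R S) :
    IsPullbackSquare (algebraMap T S) (toCompositum V g T) g (algebraMap (compositum V g T) K) ↔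
      ∀ s : S, g s ∈ compositum V g T → s ∈ T := by
  constructor
  · intro h s hs
    obtain ⟨t, ⟨ht, -⟩, -⟩ := h.existsUnique s ⟨g s, hs⟩ rfl
    rw [← ht]
    exact t.2
  · refine fun h => ⟨rfl, fun s w hsw => ?_⟩
    have hs : s ∈ T := h s (by rw [hsw]; exact w.2)
    exact ⟨⟨s, hs⟩, ⟨rfl, Subtype.ext hsw⟩, fun t ht => Subtype.ext ht.1⟩

theorem toSubmodule_compositum (T : Subalgebra R S) :
    Subalgebra.toSubmodule (compositum V g T) = Submodule.span V (g '' (T : Set S)) := by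
  have hcl : (Submonoid.closure (g '' (T : Set S)) : Set K) = g '' (T : Set S) :=
    congrArg (SetLike.coe) (Submonoid.closure_eq (T.toSubsemiring.toSubmonoid.map (g : S →* K)))
  rw [compositum, Algebra.adjoin_eq_span, hcl]

theorem isPruferExtension_of_forall_mem (hRS : IsIntegrallyClosedIn R S)
    (hV : IsSemihereditary V) [IsFractionRing V K]
    (h : ∀ (T : Subalgebra R S) (s : S), g s ∈ compositum V g T → s ∈ T) :
    IsPruferExtension R S := by
  have key (T : Subalgebra R S) (t : T) :
      (denominatorIdeal R t).map (algebraMap R T) = ⊤ := by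
    refine map_denominatorIdeal_eq_top_of_mem_adjoin_sq
      (T.val.isIntegrallyClosedIn Subtype.val_injective hRS) ?_
    have hmem : (t : S) ∈ Algebra.adjoin R {(t : S) ^ 2} := by
      refine h _ _ (hV.mem_of_sq_mem _ (Algebra.subset_adjoin ⟨(t : S) ^ 2, ?_, map_pow _ _ _⟩))
      exact Algebra.subset_adjoin rfl
    have hmap : (Algebra.adjoin R {t ^ 2}).map T.val = Algebra.adjoin R {(t : S) ^ 2} := by
      rw [AlgHom.map_adjoin]
      simp
    rw [← hmap] at hmem
    obtain ⟨u, hu, hut⟩ := hmem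
    have hut : u = t := Subtype.ext hut
    rwa [hut] at hu
  have hinj (T : Subalgebra R S) : Function.Injective (algebraMap R T) :=
    (T.val.isIntegrallyClosedIn Subtype.val_injective hRS).algebraMap_injective
  exact ⟨hRS.algebraMap_injective,
    fun T => flat_of_map_denominatorIdeal_eq_top (hinj T) (key T),
    fun T => isEpi_of_map_denominatorIdeal_eq_top (key T)⟩

variable [Algebra R V]

theorem compositum_inter_range_eq_iff
    (hD : IsPullbackSquare (algebraMap R S) (algebraMap R V) g (algebraMap V K))
    (T : Subalgebra R S) :
    (compositum V g T : Set K) ∩ Set.range g = g '' (T : Set S) ↔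
      ∀ s : S, g s ∈ compositum V g T → s ∈ T := by
  constructor
  · intro h s hs
    obtain ⟨t, ht, hts⟩ : g s ∈ g '' (T : Set S) := h ▸ ⟨hs, s, rfl⟩
    -- Since s - t ∈ ker g, pairing it with 0 ∈ V shows that it comes from R.
    obtain ⟨r, ⟨hr, -⟩, -⟩ := hD.existsUnique (s - t) 0 (by simp [hts])
    rw [← sub_add_cancel s t, ← hr]
    exact add_mem (T.algebraMap_mem r) ht
  · intro h
    ext x
    constructor
    · rintro ⟨hx, s, rfl⟩
      exact ⟨s, h s hx, rfl⟩
    · rintro ⟨t, ht, rfl⟩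
      exact ⟨Algebra.subset_adjoin ⟨t, ht, rfl⟩, t, rfl⟩

theorem isPullbackSquare_left_compositum
    (hD : IsPullbackSquare (algebraMap R S) (algebraMap R V) g (algebraMap V K))
    (T : Subalgebra R S) :
    IsPullbackSquare (algebraMap R T) (algebraMap R V) (toCompositum V g T)
      (algebraMap V (compositum V g T)) := by
  refine ⟨RingHom.ext fun r => Subtype.ext (RingHom.congr_fun hD.comm r), fun t v htv => ?_⟩
  obtain ⟨r, ⟨hr, hr'⟩, huniq⟩ := hD.existsUnique t v (congrArg Subtype.val htv)
  exact ⟨r, ⟨Subtype.ext hr, hr'⟩, fun a ha => huniq a ⟨congrArg Subtype.val ha.1, ha.2⟩⟩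

theorem mem_of_map_mem_compositum
    (hD : IsPullbackSquare (algebraMap R S) (algebraMap R V) g (algebraMap V K))
    (T : Subalgebra R S)
    (hT : ∀ t : T, (denominatorIdeal R t).map (algebraMap R T) = ⊤) {s : S}
    (hs : g s ∈ compositum V g T) : s ∈ T := by
  rw [← Subalgebra.mem_toSubmodule, toSubmodule_compositum] at hs
  obtain ⟨m, v, x, hx⟩ := Submodule.mem_span_set'.mp hs
  choose t ht htx using fun i => (x i).2
  obtain ⟨n, c, u, hc, hu⟩ := exists_common_denominators hT Finset.univ fun i => (⟨t i, ht i⟩ : T)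
  choose a ha using fun i j => mem_denominatorIdeal.mp (hc i (Finset.mem_univ i) j)
  have hcomm (r : R) : g (algebraMap R S r) = algebraMap V K (algebraMap R V r) :=
    RingHom.congr_fun hD.comm r
  have hcs (j : Fin n) : c j • s ∈ T := by
    obtain ⟨r, ⟨hr, -⟩, -⟩ := hD.existsUnique (c j • s) (∑ i, v i * algebraMap R V (a i j)) (by
      rw [Algebra.smul_def, map_mul, ← hx, map_sum, Finset.mul_sum]
      refine Finset.sum_congr rfl fun i _ => ?_
      have haij : algebraMap R S (a i j) = algebraMap R S (c j) * t i :=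
        (congrArg Subtype.val (ha i j)).trans (Algebra.smul_def _ _)
      rw [map_mul, ← hcomm (a i j), haij, map_mul, htx, Algebra.smul_def]
      ring)
    rw [← hr]
    exact T.algebraMap_mem r
  have hu' : ∑ j, c j • (u j : S) = 1 := by
    simpa using congrArg Subtype.val hu
  have hsum : s = ∑ j, c j • s * u j := by
    simp only [smul_mul_assoc, ← mul_smul_comm]
    rw [← Finset.mul_sum, hu', mul_one]
  rw [hsum]
  exact sum_mem fun j _ => mul_mem (hcs j) (u j).2

/-- Injectivity: V ⊗ T → K factors through K ⊗ T. The first map is injective by flatness, the second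
because the epimorphism property gives k ⊗ t = k g(t) ⊗ 1. -/
theorem exists_tensorProduct_algEquiv_compositum [FaithfulSMul V K]
    (hD : IsPullbackSquare (algebraMap R S) (algebraMap R V) g (algebraMap V K))
    (T : Subalgebra R S) [Module.Flat R T] [Algebra.IsEpi R T] :
    ∃ e : V ⊗[R] T ≃ₐ[V] compositum V g T,
      ∀ (v : V) (t : T), (e (v ⊗ₜ[R] t) : K) = algebraMap V K v * g t := by
  let : Algebra R K := ((algebraMap V K).comp (algebraMap R V)).toAlgebra
  have : IsScalarTower R V K := .of_algebraMap_eq fun _ => rfl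
  let g' : T →ₐ[R] K := ⟨g.comp T.val.toRingHom, fun r => RingHom.congr_fun hD.comm r⟩
  let Φ : V ⊗[R] T →ₐ[V] K :=
    Algebra.TensorProduct.lift (Algebra.ofId V K) g' fun _ _ => Commute.all _ _
  let Ψ : K ⊗[R] T →ₐ[K] K :=
    Algebra.TensorProduct.lift (AlgHom.id K K) g' fun _ _ => Commute.all _ _
  have hΦ (v : V) (t : T) : Φ (v ⊗ₜ[R] t) = algebraMap V K v * g t := rfl
  have hΨ (z : K ⊗[R] T) : Ψ z ⊗ₜ[R] (1 : T) = z := by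
    induction z using TensorProduct.induction_on with
    | zero => rw [map_zero, TensorProduct.zero_tmul]
    | tmul k t =>
      have h1 : (1 : K) ⊗ₜ[R] t = g' t ⊗ₜ[R] (1 : T) := by
        simpa using congrArg (Algebra.TensorProduct.map g' (AlgHom.id R T))
          ((Algebra.isEpi_iff_forall_one_tmul_eq R T).mp ‹_› t)
      calc (k * g' t) ⊗ₜ[R] (1 : T) = k ⊗ₜ[R] (1 : T) * g' t ⊗ₜ[R] (1 : T) := by simp
        _ = k ⊗ₜ[R] t := by rw [← h1]; simp
    | add z w hz hw => rw [map_add, TensorProduct.add_tmul, hz, hw]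
  let ι : V →ₗ[R] K := (IsScalarTower.toAlgHom R V K).toLinearMap
  have hι : Function.Injective (ι.rTensor T) :=
    Module.Flat.rTensor_preserves_injective_linearMap ι (FaithfulSMul.algebraMap_injective V K)
  have hΦΨ (z : V ⊗[R] T) : Φ z = Ψ (ι.rTensor T z) := by
    induction z using TensorProduct.induction_on with
    | zero => simp
    | tmul v t => rfl
    | add z w hz hw => rw [map_add, map_add, map_add, hz, hw]
  have hinj : Function.Injective Φ := by
    intro z w hzw
    apply hι
    rw [← hΨ (ι.rTensor T z), ← hΨ (ι.rTensor T w), ← hΦΨ, ← hΦΨ, hzw]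
  have hrange : Φ.range = compositum V g T := by
    apply le_antisymm
    · rintro _ ⟨z, rfl⟩
      induction z using TensorProduct.induction_on with
      | zero => exact (map_zero Φ).symm ▸ zero_mem _
      | tmul v t =>
        exact mul_mem ((compositum V g T).algebraMap_mem v) (map_mem_compositum V g T t)
      | add z w hz hw => exact (map_add Φ z w).symm ▸ add_mem hz hw
    · refine Algebra.adjoin_le ?_
      rintro _ ⟨t, ht, rfl⟩
      exact ⟨1 ⊗ₜ[R] ⟨t, ht⟩, by simp [hΦ]⟩
  exact ⟨(AlgEquiv.ofInjective Φ hinj).trans (Subalgebra.equivOfEq _ _ hrange), hΦ⟩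

end Square

theorem mainTheorem4 {R S V K : Type*} [CommRing R] [CommRing S] [CommRing V] [CommRing K]
    [Algebra R S] [Algebra R V] [Algebra V K] (g : S →+* K)
    (hRS : IsIntegrallyClosedIn R S)
    (hV : IsSemihereditary V)
    (hK : IsFractionRing V K)
    (hD : IsPullbackSquare (algebraMap R S) (algebraMap R V) g (algebraMap V K)) :
    (IsPruferExtension R S ↔
      ∀ T : Subalgebra R S, (compositum V g T : Set K) ∩ Set.range g = g '' (T : Set S)) ∧
    (IsPruferExtension R S ↔
      ∀ T : Subalgebra R S,
        IsPullbackSquare (algebraMap T S) (toCompositum V g T) g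
          (algebraMap (compositum V g T) K)) ∧
    (IsPruferExtension R S →
      ∀ T : Subalgebra R S,
        IsPullbackSquare (algebraMap R T) (algebraMap R V) (toCompositum V g T)
          (algebraMap V (compositum V g T)) ∧
        ∃ e : V ⊗[R] T ≃ₐ[V] compositum V g T,
          ∀ (v : V) (t : T), (e (v ⊗ₜ[R] t) : K) = algebraMap V K v * g t) := by
  have hiff : IsPruferExtension R S ↔
      ∀ (T : Subalgebra R S) (s : S), g s ∈ compositum V g T → s ∈ T := by
    refine ⟨fun hP T s hs => ?_, isPruferExtension_of_forall_mem g hRS hV⟩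
    have := hP.flat T
    have := hP.isEpi T
    exact mem_of_map_mem_compositum g hD T map_denominatorIdeal_eq_top_of_flat_of_isEpi hs
  have : FaithfulSMul V K := (faithfulSMul_iff_algebraMap_injective V K).mpr
    (IsFractionRing.injective V K)
  refine ⟨?_, ?_, fun hP T => ⟨isPullbackSquare_left_compositum g hD T, ?_⟩⟩
  · simpa only [compositum_inter_range_eq_iff g hD] using hiff
  · simpa only [isPullbackSquare_compositum_iff g] using hiff
  · have := hP.flat T
    have := hP.isEpi T
    exact exists_tensorProduct_algEquiv_compositum g hD T
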